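/- **Setting.** Let $\Lambda$ be an algebra of commuting and anticommuting c-numbers: a real Banach algebra with a splitting $\Lambda=\Lambda_0\oplus\Lambda_1$ into an even and an odd part, $1\in\Lambda_0$, $\Lambda_i\Lambda_j\subseteq\Lambda_{i+j}$ and $ab=(-1)^{ij}ba$ for $a\in\Lambda_i$, $b\in\Lambda_j$. (For ordinary real fields $\Lambda=\Lambda_0=\mathbb R$; for anticommuting fields $\Lambda$ is a Grassmann algebra.) Consider a field on space-time $\mathbb R\times\mathbb R^n$ with finitely many components $\phi^a$ and canonical momenta $\pi_a$, where $\phi^a,\pi_a$ take values in $\Lambda_{\epsilon_a}$, $\epsilon_a\in\{0,1\}$. A phase space point is a smooth map $p=(\phi,\pi)$ on $\mathbb R^n$. *Brackets.* A continuous $D=(\frac{\delta F}{\delta\phi^a},\frac{\delta F}{\delta\pi_a})$ is a (left) functional derivative of a $\Lambda$-valued functional $F$ at $p$ if $\delta F=\int\sum_a(\delta\phi^a\frac{\delta F}{\delta\phi^a}+\delta\pi_a\frac{\delta F}{\delta\pi_a})\,dV$ for all smooth compactly supported variations. A continuous $X=(X^\phi,X^\pi)$ with the parities of the fields is a Hamiltonian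 vector field of an (even) functional $G$ at $p$ if $\delta G=\int\sum_a(X^\phi_a\,\delta\pi_a-\delta\phi^a\,X^\pi_a)\,dV$ for all such variations. The generalised Poisson bracket is $\{F,G\}=\int\sum_a(X^\phi_a\frac{\delta F}{\delta\phi^a}+X^\pi_a\frac{\delta F}{\delta\pi_a})\,dV$; for commuting fields this is $\int\sum_a(\frac{\delta F}{\delta\phi^a}\frac{\delta G}{\delta\pi_a}-\frac{\delta F}{\delta\pi_a}\frac{\delta G}{\delta\phi^a})\,dV$. The smeared fields are $\phi^a(f)=\int\phi^af\,dV$ and $\pi_a(f)=\int f\pi_a\,dV$ with $f$ smooth, compactly supported, with values in $\Lambda_{\epsilon_a}$; they satisfy the canonical relations $\{\phi^a(f),\pi_b(g)\}=\delta^a_b\int gf\,dV$, i.e. $\{\phi^a(\vec x),\pi_b(\vec y)\}=\pm\delta^a_b\,\delta(\vec x-\vec y)$. *Theory.* Let a field theory be given by a Hamiltonian $H=\int\mathcal H\,dV$ whose even density $\mathcal H$ is a smooth function of $t$, $\vec x$, $\phi,\pi$ and finitely many of their spatial derivatives, and whose Hamilton equations $\partial_t(\phi,\pi)=X_H$ have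 a right-hand side of the same local and smooth kind. ($\mathcal H$ is replaced by $\mathcal H-\mathcal H|_p$ in variations at $p$, so that $H$ need not converge. No invariance of the theory is needed; Poincaré-invariant theories are included.) *Topological current.* Let $J_T^\mu$, $\mu=0,\dots,n$, be $C^1$ functions of the coordinates, of $\phi,\pi$, and of their space-time derivatives up to some order $k$, with values in $\Lambda$, such that $d_\mu J_T^\mu=0$ holds identically, i.e. for all smooth $(\phi,\pi)$ on space-time, whether or not they solve any equation of motion. Its charge is the phase space functional $Q_T(t,p)=\int J_T^0\,dV$, where the time derivatives occurring in $J_T^0$ are expressed through $p$ by Hamilton's equations. **Theorem.** Let $t\in\mathbb R$ and let $p=(\phi,\pi)$ be a phase space point at which $J_T^0$ is integrable over $\mathbb R^n$. Then, at $p$: 1. all functional derivatives of $Q_T(t,\cdot)$ vanish (zero is a functional derivative of $Q_T$), and $Q_T$ generates no transformation: the brackets $\{Q_T,\phi^a(f)\}$ and $\{Q_T,\pi_a(f)\}$ exist and are $0$ for all $a$ and $f$, i.e. $\{Q_T,\phi(\vec x)\}=0$ and $\{Q_T,\pi(\vec x)\}=0$; 2. $\{Q_T,G\}=0$ for every functional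 $G$ that has a Hamiltonian vector field at $p$, in particular $\{Q_T,H\}=0$; 3. if $Q_T$ is conserved in the sense that $\partial Q_T/\partial t$ exists and $\partial Q_T/\partial t+\{Q_T,H\}=0$, then $\partial Q_T/\partial t=0$. Moreover, if $u$ is a smooth history that solves Hamilton's equations for times near $t$, if $u(s,\cdot)-u(t,\cdot)$ has compact support for all $s$ near $t$, and if $\frac{d}{ds}Q_T(s,u(s,\cdot))\big|_{s=t}=0$, then $\frac{\partial}{\partial s}Q_T(s,u(t,\cdot))\big|_{s=t}=0$. So a conserved topological charge has no explicit time dependence. -/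

import Mathlib

open MeasureTheory Filter Topology
open scoped ContDiff

noncomputable section

namespace FieldTheory

/-- Physical space `ℝⁿ`. -/
abbrev Space (n : ℕ) : Type := EuclideanSpace ℝ (Fin n)

/-- Space-time `ℝ × ℝⁿ`; the first factor is time. -/
abbrev Spacetime (n : ℕ) : Type := ℝ × Space n

/-- The coordinate vectors of space-time: `μ = 0` is time, the others are the spatial directions. -/
def coordVec (n : ℕ) : Fin (n + 1) → Spacetime n :=
  Fin.cons (1, 0) (fun i => (0, EuclideanSpace.single i 1))

/-- The grading of an algebra `Λ` of commuting and anticommuting c-numbers: `Λ` is the direct sum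
of its even part `part 0` and its odd part `part 1`, and homogeneous elements commute up to the
usual sign.  Ordinary real numbers are the case `part 0 = ⊤`, `part 1 = ⊥` in `ℝ`;
Grassmann algebras are the case used for anticommuting fields. -/
structure SuperGrading (Λ : Type*) [NormedRing Λ] [NormedAlgebra ℝ Λ] where
  part : ZMod 2 → Submodule ℝ Λ
  one_mem : (1 : Λ) ∈ part 0
  mul_mem : ∀ {i j : ZMod 2} {a b : Λ}, a ∈ part i → b ∈ part j → a * b ∈ part (i + j)
  isCompl : IsCompl (part 0) (part 1)
  comm : ∀ {i j : ZMod 2} {a b : Λ}, a ∈ part i → b ∈ part j →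
    a * b = ((-1 : ℝ) ^ (i.val * j.val)) • (b * a)

section Phase

variable {n : ℕ} {Λ : Type*} [NormedRing Λ] [NormedAlgebra ℝ Λ]

/-- The values of the pair `(φ, π)` of a field with components `φ^a`, `a : ι`, and canonical momenta
`π_a`; `φ^a` and `π_a` are even or odd c-numbers according to the parity `par a`.
For `w : Value S par`, `(w a).1` is the value of `φ^a` and `(w a).2` that of `π_a`. -/
abbrev Value {ι : Type*} (S : SuperGrading Λ) (par : ι → ZMod 2) : Type _ :=
  (a : ι) → S.part (par a) × S.part (par a)

variable {ι : Type*} [Fintype ι] {S : SuperGrading Λ} {par : ι → ZMod 2}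

/-- Test variations: smooth and compactly supported. -/
def IsTest {E W : Type*} [NormedAddCommGroup E] [NormedSpace ℝ E] [NormedAddCommGroup W]
    [NormedSpace ℝ W] (f : E → W) : Prop :=
  ContDiff ℝ ∞ f ∧ HasCompactSupport f

/-- `D = (δF/δφ^a, δF/δπ_a)` is the (left) functional derivative at the phase space point `p` of the
functional `F`: `δF = ∫ ∑ₐ (δφ^a · δF/δφ^a + δπ_a · δF/δπ_a)` for all test variations. -/
def HasFunctionalDeriv (F : (Space n → Value S par) → Λ) (p : Space n → Value S par)
    (D : Space n → ι → Λ × Λ) : Prop :=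
  Continuous D ∧ ∀ η : Space n → Value S par, IsTest η →
    HasDerivAt (fun ε : ℝ => F (p + ε • η))
      (∫ x, ∑ a, (((η x a).1 : Λ) * (D x a).1 + ((η x a).2 : Λ) * (D x a).2)) 0

/-- `X = (X^φ, X^π)` is the Hamiltonian vector field at `p` of the even functional `G`:
`δG = ∫ ∑ₐ (X^φ_a · δπ_a - δφ^a · X^π_a)` for all test variations.  For commuting fields this says
`X^φ = δG/δπ`, `X^π = -δG/δφ`; for anticommuting ones it says `X^φ = -δG/δπ`, `X^π = -δG/δφ`
with left derivatives. -/
def IsHamiltonianField (G : (Space n → Value S par) → Λ) (p : Space n → Value S par)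
    (X : Space n → Value S par) : Prop :=
  Continuous X ∧ ∀ η : Space n → Value S par, IsTest η →
    HasDerivAt (fun ε : ℝ => G (p + ε • η))
      (∫ x, ∑ a, (((X x a).1 : Λ) * ((η x a).2 : Λ) - ((η x a).1 : Λ) * ((X x a).2 : Λ))) 0

/-- The generalised Poisson bracket `{F, G}` of a functional `F` with an even functional `G` exists
at the phase space point `p` and equals `c`.  For commuting fields it is the usual
`∫ ∑ₐ (δF/δφ^a · δG/δπ_a - δF/δπ_a · δG/δφ^a)`, and for anticommuting ones
`(-1)^|F| ∫ ∑ₐ (δF/δφ^a · δG/δπ_a + δF/δπ_a · δG/δφ^a)` with left derivatives. -/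
def HasBracket (F G : (Space n → Value S par) → Λ) (p : Space n → Value S par) (c : Λ) : Prop :=
  ∃ (D : Space n → ι → Λ × Λ) (X : Space n → Value S par),
    HasFunctionalDeriv F p D ∧ IsHamiltonianField G p X ∧
    Integrable (fun x => ∑ a, (((X x a).1 : Λ) * (D x a).1 + ((X x a).2 : Λ) * (D x a).2)) ∧
    c = ∫ x, ∑ a, (((X x a).1 : Λ) * (D x a).1 + ((X x a).2 : Λ) * (D x a).2)

/-- The smeared field `∫ φ^a(x) f(x) dx`; the smearing function has the parity of the field, so
that the result is even. -/
def fieldObs (a : ι) (f : Space n → S.part (par a)) (p : Space n → Value S par) : Λ :=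
  ∫ x, ((p x a).1 : Λ) * (f x : Λ)

/-- The smeared canonical momentum `∫ f(x) π_a(x) dx`. -/
def momentumObs (a : ι) (f : Space n → S.part (par a)) (p : Space n → Value S par) : Λ :=
  ∫ x, (f x : Λ) * ((p x a).2 : Λ)

open Classical in
theorem field_hasFunctionalDeriv [CompleteSpace Λ] (a : ι)
    (f : Space n → S.part (par a)) (hf : IsTest f) (p : Space n → Value S par)
    (hp : ContDiff ℝ ∞ p) :
    HasFunctionalDeriv (fieldObs a f) p (fun x b => if b = a then ((f x : Λ), 0) else 0) := by
  have hfc : Continuous fun x => (f x : Λ) := continuous_subtype_val.comp hf.1.continuous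
  have hfs : HasCompactSupport fun x => (f x : Λ) :=
    hf.2.comp_left (g := (Subtype.val : S.part (par a) → Λ)) rfl
  have hI : ∀ q : Space n → Value S par, Continuous q →
      Integrable fun x => ((q x a).1 : Λ) * (f x : Λ) := fun q hq =>
    Continuous.integrable_of_hasCompactSupport
      ((continuous_subtype_val.comp (continuous_fst.comp ((continuous_apply a).comp hq))).mul hfc)
      hfs.mul_left
  constructor
  · refine continuous_pi fun b => ?_
    by_cases h : b = a
    · simpa [h] using hfc.prodMk continuous_const
    · simpa [h] using continuous_const
  · intro η hη
    have e : (fun ε : ℝ => fieldObs a f (p + ε • η)) = fun ε : ℝ =>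
        fieldObs a f p + ε • ∫ x, ((η x a).1 : Λ) * (f x : Λ) := by
      ext ε
      simp only [fieldObs]
      rw [← integral_smul]
      refine Eq.trans ?_ (integral_add (hI p hp.continuous) ((hI η hη.1.continuous).smul ε))
      congr 1; ext x; simp [add_mul]
    rw [e]
    have : (∫ x, ∑ b, (((η x b).1 : Λ) * (if b = a then ((f x : Λ), (0 : Λ)) else 0).1 +
        ((η x b).2 : Λ) * (if b = a then ((f x : Λ), (0 : Λ)) else 0).2)) =
        ∫ x, ((η x a).1 : Λ) * (f x : Λ) := by
      congr 1; ext x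
      rw [Finset.sum_eq_single a]
      · simp
      · intro b _ h; simp [h]
      · simp
    rw [this]
    simpa using ((hasDerivAt_id (0:ℝ)).smul_const (∫ x, ((η x a).1 : Λ) * (f x : Λ))).const_add (fieldObs a f p)

open Classical in
theorem momentum_ham [CompleteSpace Λ] (a : ι)
    (f : Space n → S.part (par a)) (hf : IsTest f) (p : Space n → Value S par)
    (hp : ContDiff ℝ ∞ p) :
    IsHamiltonianField (momentumObs a f) p (fun x => Function.update 0 a (f x, 0)) := by
  have hfc : Continuous fun x => (f x : Λ) := continuous_subtype_val.comp hf.1.continuous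
  have hfs : HasCompactSupport fun x => (f x : Λ) :=
    hf.2.comp_left (g := (Subtype.val : S.part (par a) → Λ)) rfl
  have hI : ∀ q : Space n → Value S par, Continuous q →
      Integrable fun x => (f x : Λ) * ((q x a).2 : Λ) := fun q hq =>
    Continuous.integrable_of_hasCompactSupport
      (hfc.mul (continuous_subtype_val.comp (continuous_snd.comp ((continuous_apply a).comp hq))))
      hfs.mul_right
  constructor
  · exact continuous_const.update a (hf.1.continuous.prodMk continuous_const)
  · intro η hη
    have e : (fun ε : ℝ => momentumObs a f (p + ε • η)) = fun ε : ℝ =>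
        momentumObs a f p + ε • ∫ x, (f x : Λ) * ((η x a).2 : Λ) := by
      ext ε
      simp only [momentumObs]
      rw [← integral_smul]
      refine Eq.trans ?_ (integral_add (hI p hp.continuous) ((hI η hη.1.continuous).smul ε))
      congr 1; ext x; simp [mul_add]
    rw [e]
    have : (∫ x, ∑ b, ((((Function.update 0 a (f x, 0) : Value S par) b).1 : Λ) * ((η x b).2 : Λ) -
        ((η x b).1 : Λ) * (((Function.update 0 a (f x, 0) : Value S par) b).2 : Λ))) =
        ∫ x, (f x : Λ) * ((η x a).2 : Λ) := by
      congr 1; ext x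
      rw [Finset.sum_eq_single a]
      · simp
      · intro b _ h; simp [h]
      · simp
    rw [this]
    simpa using ((hasDerivAt_id (0:ℝ)).smul_const (∫ x, (f x : Λ) * ((η x a).2 : Λ))).const_add (momentumObs a f p)

open Classical in
/-- The canonical Poisson brackets `{φ^a(f), π_b(g)} = δ^a_b ∫ g f`. -/
theorem canonical_bracket [CompleteSpace Λ] (a b : ι)
    (f : Space n → S.part (par a)) (hf : IsTest f) (g : Space n → S.part (par b)) (hg : IsTest g)
    (p : Space n → Value S par) (hp : ContDiff ℝ ∞ p) :
    HasBracket (fieldObs a f) (momentumObs b g) p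
      (if a = b then ∫ x, (g x : Λ) * (f x : Λ) else 0) := by
  have hfc : Continuous fun x => (f x : Λ) := continuous_subtype_val.comp hf.1.continuous
  have hgc : Continuous fun x => (g x : Λ) := continuous_subtype_val.comp hg.1.continuous
  have hfs : HasCompactSupport fun x => (f x : Λ) :=
    hf.2.comp_left (g := (Subtype.val : S.part (par a) → Λ)) rfl
  refine ⟨_, _, field_hasFunctionalDeriv a f hf p hp, momentum_ham b g hg p hp, ?_⟩
  have key : (fun x => ∑ d, ((((Function.update 0 b (g x, 0) : Value S par) d).1 : Λ) *
      (if d = a then ((f x : Λ), (0 : Λ)) else 0).1 +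
      (((Function.update 0 b (g x, 0) : Value S par) d).2 : Λ) *
      (if d = a then ((f x : Λ), (0 : Λ)) else 0).2)) =
      fun x => if a = b then (g x : Λ) * (f x : Λ) else 0 := by
    ext x
    rw [Finset.sum_eq_single b]
    · by_cases h : a = b
      · simp [h]
      · simp [h, Ne.symm h]
    · intro d _ h; simp [h]
    · simp
  rw [key]
  by_cases h : a = b
  · simp only [h, if_true, and_true]
    exact (hgc.mul hfc).integrable_of_hasCompactSupport hfs.mul_left
  · simp [h]

end Phase

section Jets

variable {E W : Type*} [NormedAddCommGroup E] [NormedSpace ℝ E] [NormedAddCommGroup W]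
  [NormedSpace ℝ W]

/-- The values of all derivatives of order at most `k` of a function `E → W` at a point. -/
abbrev Jet (k : ℕ) (E W : Type*) [NormedAddCommGroup E] [NormedSpace ℝ E] [NormedAddCommGroup W]
    [NormedSpace ℝ W] : Type _ :=
  (i : Fin (k + 1)) → ContinuousMultilinearMap ℝ (fun _ : Fin (i : ℕ) => E) W

/-- The `k`-jet of `u` at `x`. -/
def jet (k : ℕ) (u : E → W) (x : E) : Jet k E W := fun i => iteratedFDeriv ℝ (i : ℕ) u x

end Jets

/-- A classical field theory in Hamiltonian form: a local Hamiltonian `H = ∫ density`, where the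
density is a smooth function of time, position, the fields `φ, π` and finitely many of their spatial
derivatives, together with the right-hand side `velocity` of Hamilton's equations
`∂_t (φ, π) = velocity`, which is local and smooth as well.
As `H` itself may be infinite, Hamilton's equations refer to the energy relative to `p`. -/
structure HamiltonianTheory (n : ℕ) {Λ : Type*} [NormedRing Λ] [NormedAlgebra ℝ Λ]
    {ι : Type*} [Fintype ι] (S : SuperGrading Λ) (par : ι → ZMod 2) where
  order : ℕ
  density : Spacetime n → Jet order (Space n) (Value S par) → Λ
  density_smooth : ContDiff ℝ ∞ (fun z : Spacetime n × Jet order (Space n) (Value S par) =>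
    density z.1 z.2)
  density_even : ∀ y j, density y j ∈ S.part 0
  velocityOrder : ℕ
  velocity : Spacetime n → Jet velocityOrder (Space n) (Value S par) → Value S par
  velocity_smooth : ContDiff ℝ ∞
    (fun z : Spacetime n × Jet velocityOrder (Space n) (Value S par) => velocity z.1 z.2)
  hamilton : ∀ (t : ℝ) (p : Space n → Value S par), ContDiff ℝ ∞ p →
    IsHamiltonianField
      (fun q => ∫ x, (density (t, x) (jet order q x) - density (t, x) (jet order p x)))
      p (fun x => velocity (t, x) (jet velocityOrder p x))

section Charge

variable {n : ℕ} {Λ : Type*} [NormedRing Λ] [NormedAlgebra ℝ Λ]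
  {ι : Type*} [Fintype ι] {S : SuperGrading Λ} {par : ι → ZMod 2}

namespace HamiltonianTheory

/-- The Hamiltonian at time `t`, measured relative to the phase space point `p`. -/
def hamiltonian (T : HamiltonianTheory n S par) (t : ℝ) (p q : Space n → Value S par) : Λ :=
  ∫ x, (T.density (t, x) (jet T.order q x) - T.density (t, x) (jet T.order p x))

/-- The Hamiltonian vector field on phase space at time `t`. -/
def evolution (T : HamiltonianTheory n S par) (t : ℝ) (p : Space n → Value S par) :
    Space n → Value S par :=
  fun x => T.velocity (t, x) (jet T.velocityOrder p x)

/-- `u` obeys Hamilton's equations at all times near `t`. -/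
def IsMotionNear (T : HamiltonianTheory n S par) (t : ℝ) (u : Spacetime n → Value S par) : Prop :=
  ∀ᶠ s in 𝓝 t, ∀ x, HasDerivAt (fun r => u (r, x)) (T.evolution s (fun y => u (s, y)) x) s

/-- The `j`-th time derivative of `(φ, π)`, expressed at time `t` through the phase space
point `p` alone by repeated use of Hamilton's equations. -/
def timeDeriv (T : HamiltonianTheory n S par) :
    ℕ → ℝ → (Space n → Value S par) → Space n → Value S par
  | 0 => fun _ p => p
  | j + 1 => fun t p x => deriv (fun s : ℝ => T.timeDeriv j (t + s) (p + s • T.evolution t p) x) 0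

/-- A history through `p` at time `t` whose time derivatives at `t` up to order `k` are the ones
that Hamilton's equations prescribe. -/
def history (T : HamiltonianTheory n S par) (k : ℕ) (t : ℝ) (p : Space n → Value S par) :
    Spacetime n → Value S par :=
  fun y => ∑ j ∈ Finset.range (k + 1),
    ((y.1 - t) ^ j / (j.factorial : ℝ)) • T.timeDeriv j t p y.2

end HamiltonianTheory

/-- A current: each component is a function of the coordinates, the fields `φ, π`, and
their space-time derivatives of order at most `k`. -/
abbrev Current (n k : ℕ) {Λ : Type*} [NormedRing Λ] [NormedAlgebra ℝ Λ]
    {ι : Type*} [Fintype ι] (S : SuperGrading Λ) (par : ι → ZMod 2) : Type _ :=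
  Fin (n + 1) → Spacetime n → Jet k (Spacetime n) (Value S par) → Λ

variable {k : ℕ}

/-- A topological current: continuously differentiable in all its arguments, and its total
divergence vanishes for all smooth histories of the fields, whether or not they obey any equation
of motion. -/
def IsTopologicalCurrent (J : Current n k S par) : Prop :=
  (∀ μ, ContDiff ℝ 1 (fun z : Spacetime n × Jet k (Spacetime n) (Value S par) => J μ z.1 z.2)) ∧
  ∀ u : Spacetime n → Value S par, ContDiff ℝ ∞ u → ∀ y : Spacetime n,
    ∑ μ, fderiv ℝ (fun z => J μ z (jet k u z)) y (coordVec n μ) = 0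

/-- The charge density `J⁰` at time `t` as a function on phase space. -/
def chargeDensity (T : HamiltonianTheory n S par) (J : Current n k S par) (t : ℝ)
    (p : Space n → Value S par) (x : Space n) : Λ :=
  J 0 (t, x) (jet k (T.history k t p) (t, x))

/-- The charge `Q = ∫ J⁰ dV` at time `t` as a functional on phase space. -/
def charge (T : HamiltonianTheory n S par) (J : Current n k S par) (t : ℝ)
    (p : Space n → Value S par) : Λ :=
  ∫ x, chargeDensity T J t p x

end Charge

end FieldTheory

end

open FieldTheory

/-! Compactly supported variations cannot change a topological charge. Let two phase space points
agree outside a compact set `K`. Each is prolonged to a history, polynomial in time, whose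
coefficients are the time derivatives dictated by Hamilton's equations. These derivatives are local
in space, so the histories `u`, `v` agree outside `K` at all times. A time cutoff gives a history
`w` equal to `u` near `t` and to `v` in the past. It solves no equation, but the current is
conserved off shell, and the difference of the currents of `w` and `v` vanishes outside `K`. The
integral of its density is therefore constant in time; being zero in the past, it is zero at `t`
(`IsTopologicalCurrent.integral_sub_eq_zero`).

So the charge is constant along every test variation (`charge_eq_of_hasCompactSupport_sub`), zero is
a functional derivative, and all brackets vanish. The same invariance, applied at each time near
`t`, turns conservation along a motion into the absence of explicit time dependence. -/

namespace FieldTheory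

/-! ### Smoothness and locality of jets. -/

section Calculus

variable {E W : Type*} [NormedAddCommGroup E] [NormedSpace ℝ E] [NormedAddCommGroup W]
  [NormedSpace ℝ W]

theorem contDiff_jet (k : ℕ) {u : E → W} (hu : ContDiff ℝ ∞ u) : ContDiff ℝ ∞ (jet k u) :=
  contDiff_pi.2 fun _ => hu.iteratedFDeriv_right (m := ∞) le_rfl

theorem jet_congr (k : ℕ) {u v : E → W} {x : E} (h : u =ᶠ[𝓝 x] v) : jet k u x = jet k v x :=
  funext fun i => (h.iteratedFDeriv ℝ (i : ℕ)).eq_of_nhds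

/-- The jets in the second variable of a smooth function of two variables depend smoothly on both
variables. -/
theorem contDiff_jet_slice {P : Type*} [NormedAddCommGroup P] [NormedSpace ℝ P] (k : ℕ)
    {f : P × E → W} (hf : ContDiff ℝ ∞ f) :
    ContDiff ℝ ∞ (fun z : P × E => jet k (fun y => f (z.1, y)) z.2) := by
  refine contDiff_pi.2 fun i => ?_
  have key : (fun z : P × E => jet k (fun y => f (z.1, y)) z.2 i) = fun z =>
      ContinuousMultilinearMap.compContinuousLinearMapL (𝕜 := ℝ) (F := W)
        (fun _ : Fin (i : ℕ) => ContinuousLinearMap.inr ℝ P E) (iteratedFDeriv ℝ (i : ℕ) f z) := by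
    ext1 z
    -- Translating the slice to the origin of `P` turns the affine inclusion of `E` into the linear
    -- map `inr`, to which the chain rule for iterated derivatives applies.
    have hsh : ContDiff ℝ ∞ (fun w : P × E => f (w + (z.1, 0))) :=
      hf.comp (contDiff_id.add contDiff_const)
    have h := (ContinuousLinearMap.inr ℝ P E).iteratedFDeriv_comp_right hsh z.2
      (i := (i : ℕ)) (by exact_mod_cast le_top)
    have e : (fun w : P × E => f (w + (z.1, 0))) ∘ ContinuousLinearMap.inr ℝ P E =
        fun y => f (z.1, y) := by
      ext y; simp
    rw [e, iteratedFDeriv_comp_add_right] at h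
    simpa [jet] using h
  rw [key]
  exact (ContinuousLinearMap.contDiff _).comp (hf.iteratedFDeriv_right (m := ∞) le_rfl)

end Calculus

/-! ### Conservation of charge for currents of spatially compact support. -/

section Conservation

variable {n : ℕ} {V : Type*} [NormedAddCommGroup V] [NormedSpace ℝ V]

/-- Integration by parts against the constant function 1: there are no boundary terms. -/
theorem integral_fderiv_eq_zero {E : Type*} [NormedAddCommGroup E] [NormedSpace ℝ E]
    [FiniteDimensional ℝ E] [MeasurableSpace E] [BorelSpace E] (μ : Measure E)
    [μ.IsAddHaarMeasure] {f : E → V} (hf : ContDiff ℝ 1 f) (hs : HasCompactSupport f) (v : E) :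
    ∫ x, fderiv ℝ f x v ∂μ = 0 := by
  have hc : Continuous fun x => fderiv ℝ f x v :=
    (hf.continuous_fderiv one_ne_zero).clm_apply continuous_const
  have := integral_smul_fderiv_eq_neg_fderiv_smul_of_integrable (μ := μ) (𝕜 := ℝ)
    (f := fun _ : E => (1 : ℝ)) (g := f) (v := v) (by simp)
    (by simpa using hc.integrable_of_hasCompactSupport (hs.fderiv_apply ℝ v))
    (by simpa using hf.continuous.integrable_of_hasCompactSupport hs)
    (fun _ _ => differentiableAt_const _)
    (fun x _ => hf.differentiable one_ne_zero x)
  simpa using this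

theorem fderiv_slice {P E : Type*} [NormedAddCommGroup P] [NormedSpace ℝ P]
    [NormedAddCommGroup E] [NormedSpace ℝ E] {f : P × E → V} (hf : Differentiable ℝ f) (s : P)
    (x v : E) : fderiv ℝ (fun y => f (s, y)) x v = fderiv ℝ f (s, x) (0, v) := by
  have h : HasFDerivAt (fun y : E => (s, y)) (ContinuousLinearMap.inr ℝ P E) x :=
    hasFDerivAt_prodMk_right s x
  have := (HasFDerivAt.comp x (hf (s, x)).hasFDerivAt h).fderiv
  simp [Function.comp_def] at this
  rw [this]; simp

theorem hasDerivAt_slice {E : Type*} [NormedAddCommGroup E] [NormedSpace ℝ E] {f : ℝ × E → V}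
    (hf : Differentiable ℝ f) (s : ℝ) (x : E) :
    HasDerivAt (fun r => f (r, x)) (fderiv ℝ f (s, x) (1, 0)) s :=
  (hf (s, x)).hasFDerivAt.comp_hasDerivAt s ((hasDerivAt_id s).prodMk (hasDerivAt_const s x))

/-- Differentiation under the integral sign for a `C¹` function of uniformly compact support. -/
theorem hasDerivAt_integral_of_compact {E : Type*} [NormedAddCommGroup E] [NormedSpace ℝ E]
    [FiniteDimensional ℝ E] [MeasurableSpace E] [BorelSpace E] (μ : Measure E)
    [IsFiniteMeasureOnCompacts μ] {f : ℝ × E → V} (hf : ContDiff ℝ 1 f) {K : Set E}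
    (hK : IsCompact K) (hfK : ∀ s, ∀ x ∉ K, f (s, x) = 0) (s : ℝ) :
    HasDerivAt (fun r => ∫ x, f (r, x) ∂μ) (∫ x, fderiv ℝ f (s, x) (1, 0) ∂μ) s := by
  have hd := hf.differentiable one_ne_zero
  have hc : Continuous fun z => fderiv ℝ f z (1, 0) :=
    (hf.continuous_fderiv one_ne_zero).clm_apply continuous_const
  have hfc : ∀ r, Continuous fun x => f (r, x) := fun r =>
    hf.continuous.comp (by fun_prop)
  obtain ⟨C, hC⟩ := ((isCompact_Icc (a := s - 1) (b := s + 1)).prod hK).exists_bound_of_continuousOn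
    hc.continuousOn
  refine (hasDerivAt_integral_of_dominated_loc_of_deriv_le (s := Set.Icc (s - 1) (s + 1))
    (F := fun r x => f (r, x)) (F' := fun r x => fderiv ℝ f (r, x) (1, 0))
    (bound := K.indicator fun _ => C)
    (Icc_mem_nhds (by linarith) (by linarith)) ?_ ?_ ?_ ?_ ?_ ?_).2
  · exact Eventually.of_forall fun r => (hfc r).aestronglyMeasurable
  · exact (hfc s).integrable_of_hasCompactSupport (HasCompactSupport.intro hK (hfK s))
  · exact (hc.comp (by fun_prop : Continuous fun x : E => (s, x))).aestronglyMeasurable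
  · refine Eventually.of_forall fun x r hr => ?_
    by_cases hx : x ∈ K
    · simpa [hx] using hC (r, x) ⟨hr, hx⟩
    -- Off `K` the function is zero at every time, so its time derivative vanishes too and the
    -- indicator bound holds there.
    · have h := hasDerivAt_slice hd r x
      have h0 : (fun r => f (r, x)) = fun _ => 0 := funext fun r => hfK r x hx
      rw [h0] at h
      simp [hx, h.unique (hasDerivAt_const r 0)]
  · exact (integrable_indicator_iff hK.measurableSet).2
      (integrableOn_const hK.measure_lt_top.ne)
  · exact Eventually.of_forall fun x r _ => hasDerivAt_slice hd r x

/-- A conserved current of spatially compact support has a constant charge. -/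
theorem integral_eq_of_divergence_eq_zero {g : Fin (n + 1) → Spacetime n → V}
    (hg : ∀ μ, ContDiff ℝ 1 (g μ)) {K : Set (Space n)} (hK : IsCompact K)
    (hgK : ∀ μ s, ∀ x ∉ K, g μ (s, x) = 0)
    (hdiv : ∀ y, ∑ μ, fderiv ℝ (g μ) y (coordVec n μ) = 0) (s s' : ℝ) :
    ∫ x, g 0 (s, x) = ∫ x, g 0 (s', x) := by
  have hslice : ∀ μ s, ContDiff ℝ 1 fun x => g μ (s, x) := fun μ s =>
    (hg μ).comp (contDiff_const.prodMk contDiff_id)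
  have hsupp : ∀ μ s, HasCompactSupport fun x => g μ (s, x) := fun μ s =>
    HasCompactSupport.intro hK (hgK μ s)
  have hzero : ∀ s, ∫ x, fderiv ℝ (g 0) (s, x) (1, 0) = 0 := by
    intro s
    -- The continuity equation trades the time derivative for a spatial divergence, which integrates
    -- to zero.
    have e : (fun x => fderiv ℝ (g 0) (s, x) (1, 0)) = fun x =>
        -∑ i : Fin n, fderiv ℝ (fun y => g i.succ (s, y)) x (EuclideanSpace.single i 1) := by
      ext x
      have h := hdiv (s, x)
      rw [Fin.sum_univ_succ] at h
      simp only [coordVec, Fin.cons_zero, Fin.cons_succ] at h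
      rw [eq_neg_of_add_eq_zero_left h]
      congr 1
      exact Finset.sum_congr rfl fun i _ =>
        (fderiv_slice ((hg i.succ).differentiable one_ne_zero) s x _).symm
    rw [e, integral_neg, integral_finsetSum]
    · simp [integral_fderiv_eq_zero volume (hslice _ s) (hsupp _ s)]
    · intro i _
      exact (((hslice i.succ s).continuous_fderiv one_ne_zero).clm_apply
        continuous_const).integrable_of_hasCompactSupport ((hsupp i.succ s).fderiv_apply ℝ _)
  have hder : ∀ s, HasDerivAt (fun r => ∫ x, g 0 (r, x)) 0 s := fun s => by
    simpa only [hzero s] using hasDerivAt_integral_of_compact volume (hg 0) hK (hgK 0) s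
  exact is_const_of_deriv_eq_zero (fun s => (hder s).differentiableAt) (fun s => (hder s).deriv) s s'

end Conservation

/-! ### Prolonging phase space points to histories. -/

section History

variable {n : ℕ} {Λ : Type*} [NormedRing Λ] [NormedAlgebra ℝ Λ]
  {ι : Type*} [Fintype ι] {S : SuperGrading Λ} {par : ι → ZMod 2}
  (T : HamiltonianTheory n S par)

theorem HamiltonianTheory.contDiff_evolution {P : Type*} [NormedAddCommGroup P] [NormedSpace ℝ P]
    {τ : P → ℝ} (hτ : ContDiff ℝ ∞ τ) {p : P × Space n → Value S par} (hp : ContDiff ℝ ∞ p) :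
    ContDiff ℝ ∞ fun z : P × Space n => T.evolution (τ z.1) (fun y => p (z.1, y)) z.2 :=
  T.velocity_smooth.comp (((hτ.comp contDiff_fst).prodMk contDiff_snd).prodMk
    (contDiff_jet_slice T.velocityOrder hp))

/-- The time derivatives prescribed by Hamilton's equations depend smoothly on position and on any
parameters on which the time and the phase space point depend smoothly. -/
theorem HamiltonianTheory.contDiff_timeDeriv (j : ℕ) : ∀ {P : Type} [NormedAddCommGroup P]
    [NormedSpace ℝ P] {τ : P → ℝ}, ContDiff ℝ ∞ τ → ∀ {p : P × Space n → Value S par},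
    ContDiff ℝ ∞ p →
    ContDiff ℝ ∞ fun z : P × Space n => T.timeDeriv j (τ z.1) (fun y => p (z.1, y)) z.2 := by
  -- The parameter space stays general because each step enlarges it from `P` to `P × ℝ`, the new
  -- parameter being the flow time `s`.
  induction j with
  | zero => intro P _ _ τ _ p hp; exact hp
  | succ j ih =>
    intro P _ _ τ hτ p hp
    have hev := T.contDiff_evolution hτ hp
    have hτ' : ContDiff ℝ ∞ fun w : P × ℝ => τ w.1 + w.2 :=
      (hτ.comp contDiff_fst).add contDiff_snd
    have hproj : ContDiff ℝ ∞ fun z : (P × ℝ) × Space n => (z.1.1, z.2) := by fun_prop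
    have hp' : ContDiff ℝ ∞ fun z : (P × ℝ) × Space n =>
        p (z.1.1, z.2) + z.1.2 • T.evolution (τ z.1.1) (fun y => p (z.1.1, y)) z.2 :=
      (hp.comp hproj).add ((by fun_prop : ContDiff ℝ ∞ fun z : (P × ℝ) × Space n => z.1.2).smul
        (hev.comp hproj))
    have hF := ih hτ' hp'
    set F : (P × ℝ) × Space n → Value S par := fun z => T.timeDeriv j (τ z.1.1 + z.1.2)
      (fun y => p (z.1.1, y) + z.1.2 • T.evolution (τ z.1.1) (fun y => p (z.1.1, y)) y) z.2
    -- The next time derivative is the partial derivative of the smooth `F` in the new parameter at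
    -- 0.
    have e : (fun z : P × Space n => T.timeDeriv (j + 1) (τ z.1) (fun y => p (z.1, y)) z.2) =
        fun z => fderiv ℝ F ((z.1, 0), z.2) ((0, 1), 0) := by
      ext1 z
      have h1 : HasDerivAt (fun s : ℝ => ((z.1, s), z.2)) (((0 : P), (1 : ℝ)), (0 : Space n)) 0 :=
        ((hasDerivAt_const 0 z.1).prodMk (hasDerivAt_id 0)).prodMk (hasDerivAt_const 0 z.2)
      have h2 := ((hF.differentiable (by simp) ((z.1, 0), z.2)).hasFDerivAt).comp_hasDerivAt
        (0 : ℝ) h1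
      exact h2.deriv
    rw [e]
    exact ((hF.fderiv_right (m := ∞) le_rfl).comp (by fun_prop)).clm_apply contDiff_const

/-- The time derivatives prescribed by Hamilton's equations are local in space. -/
theorem HamiltonianTheory.timeDeriv_congr {U : Set (Space n)} (hU : IsOpen U) (j : ℕ) :
    ∀ (t : ℝ) {p q : Space n → Value S par}, Set.EqOn p q U →
      Set.EqOn (T.timeDeriv j t p) (T.timeDeriv j t q) U := by
  induction j with
  | zero => intro t p q h; exact h
  | succ j ih =>
    intro t p q h x hx
    have hev : Set.EqOn (T.evolution t p) (T.evolution t q) U := fun y hy => by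
      simp only [HamiltonianTheory.evolution]
      rw [jet_congr _ (h.eventuallyEq_of_mem (hU.mem_nhds hy))]
    have e : (fun s : ℝ => T.timeDeriv j (t + s) (p + s • T.evolution t p) x) =
        fun s => T.timeDeriv j (t + s) (q + s • T.evolution t q) x :=
      funext fun s => ih (t + s) (fun y hy => by simp [h hy, hev hy]) hx
    simp only [HamiltonianTheory.timeDeriv, e]

theorem HamiltonianTheory.contDiff_history (k : ℕ) (t : ℝ) {p : Space n → Value S par}
    (hp : ContDiff ℝ ∞ p) : ContDiff ℝ ∞ (T.history k t p) := by
  unfold HamiltonianTheory.history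
  refine ContDiff.sum fun j _ => ContDiff.smul
    (((contDiff_fst.sub contDiff_const).pow j).div_const _) ?_
  -- The time coordinate enters only as a dummy parameter.
  exact T.contDiff_timeDeriv j (P := ℝ) (τ := fun _ => t) contDiff_const
    (p := fun z => p z.2) (hp.comp contDiff_snd)

theorem HamiltonianTheory.history_congr (k : ℕ) (t : ℝ) {U : Set (Space n)} (hU : IsOpen U)
    {p q : Space n → Value S par} (h : Set.EqOn p q U) {y : Spacetime n} (hy : y.2 ∈ U) :
    T.history k t p y = T.history k t q y := by
  simp only [HamiltonianTheory.history]
  exact Finset.sum_congr rfl fun j _ => by rw [T.timeDeriv_congr hU j t h hy]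

/-! ### Deformation invariance of the topological charge. -/

variable {k : ℕ} {J : Current n k S par}

/-- The difference of the topological charges of two histories that agree outside a spatially
compact region is constant in time. -/
theorem IsTopologicalCurrent.integral_sub_eq (hJ : IsTopologicalCurrent J)
    {u v : Spacetime n → Value S par} (hu : ContDiff ℝ ∞ u) (hv : ContDiff ℝ ∞ v)
    {K : Set (Space n)} (hK : IsCompact K) (huv : ∀ y : Spacetime n, y.2 ∉ K → u y = v y)
    (s s' : ℝ) :
    ∫ x, (J 0 (s, x) (jet k u (s, x)) - J 0 (s, x) (jet k v (s, x))) =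
      ∫ x, (J 0 (s', x) (jet k u (s', x)) - J 0 (s', x) (jet k v (s', x))) := by
  have hcomp : ∀ {w : Spacetime n → Value S par}, ContDiff ℝ ∞ w → ∀ μ,
      ContDiff ℝ 1 fun z => J μ z (jet k w z) := fun hw μ =>
    (hJ.1 μ).comp (contDiff_id.prodMk ((contDiff_jet k hw).of_le (by exact_mod_cast le_top)))
  refine integral_eq_of_divergence_eq_zero (hK := hK)
    (g := fun μ z => J μ z (jet k u z) - J μ z (jet k v z))
    (fun μ => (hcomp hu μ).sub (hcomp hv μ)) ?_ ?_ s s'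
  · intro μ s x hx
    have hopen : IsOpen {y : Spacetime n | y.2 ∉ K} :=
      hK.isClosed.isOpen_compl.preimage continuous_snd
    have : u =ᶠ[𝓝 (s, x)] v := by
      filter_upwards [hopen.mem_nhds (show (s, x) ∈ {y : Spacetime n | y.2 ∉ K} from hx)] with y hy
      exact huv y hy
    simp [jet_congr k this]
  · intro y
    have : ∀ μ, fderiv ℝ (fun z => J μ z (jet k u z) - J μ z (jet k v z)) y =
        fderiv ℝ (fun z => J μ z (jet k u z)) y - fderiv ℝ (fun z => J μ z (jet k v z)) y :=
      fun μ => fderiv_fun_sub ((hcomp hu μ).differentiable one_ne_zero y)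
        ((hcomp hv μ).differentiable one_ne_zero y)
    simp [this, hJ.2 u hu y, hJ.2 v hv y]

/-- At every time, histories that agree outside a spatially compact region have the same
topological charge: one can be deformed into the other in the past. -/
theorem IsTopologicalCurrent.integral_sub_eq_zero (hJ : IsTopologicalCurrent J)
    {u v : Spacetime n → Value S par} (hu : ContDiff ℝ ∞ u) (hv : ContDiff ℝ ∞ v)
    {K : Set (Space n)} (hK : IsCompact K) (huv : ∀ y : Spacetime n, y.2 ∉ K → u y = v y)
    (t : ℝ) :
    ∫ x, (J 0 (t, x) (jet k u (t, x)) - J 0 (t, x) (jet k v (t, x))) = 0 := by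
  -- The cutoff is 1 within distance 1 of `t` and 0 beyond distance 2, so `w` has the jets of `u` at
  -- time `t` and those of `v` at time `t - 3`.
  let χ : ContDiffBump t := ⟨1, 2, one_pos, one_lt_two⟩
  let w : Spacetime n → Value S par := fun y => v y + χ y.1 • (u y - v y)
  have hw : ContDiff ℝ ∞ w := hv.add (((χ.contDiff).comp contDiff_fst).smul (hu.sub hv))
  have hwv : ∀ y : Spacetime n, y.2 ∉ K → w y = v y := fun y hy => by simp [w, huv y hy]
  have hnow : ∀ x, jet k w (t, x) = jet k u (t, x) := fun x => by
    refine jet_congr k ?_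
    have hfst : Tendsto Prod.fst (𝓝 ((t, x) : Spacetime n)) (𝓝 t) := continuous_fst.continuousAt
    filter_upwards [hfst.eventually χ.eventuallyEq_one] with y hy
    simp [w, hy]
  have hpast : ∀ x, jet k w (t - 3, x) = jet k v (t - 3, x) := fun x => by
    refine jet_congr k ?_
    have : {y : Spacetime n | y.1 < t - 2} ∈ 𝓝 (t - 3, x) :=
      (isOpen_lt continuous_fst continuous_const).mem_nhds (by simp; linarith)
    filter_upwards [this] with y hy
    have h0 : χ y.1 = 0 := χ.zero_of_le_dist (by
      have hy' : y.1 < t - 2 := hy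
      rw [Real.dist_eq, abs_sub_comm, abs_of_pos (by linarith)]
      show (2 : ℝ) ≤ _
      linarith)
    simp [w, h0]
  have h := hJ.integral_sub_eq hw hv hK hwv t (t - 3)
  simpa [hnow, hpast] using h

/-- The topological charge is unchanged by compactly supported variations. -/
theorem charge_eq_of_hasCompactSupport_sub (hJ : IsTopologicalCurrent J) (t : ℝ)
    {p q : Space n → Value S par} (hp : ContDiff ℝ ∞ p) (hq : ContDiff ℝ ∞ q)
    (h : HasCompactSupport (q - p)) : charge T J t q = charge T J t p := by
  have hpq : Set.EqOn q p (tsupport (q - p))ᶜ := fun x hx =>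
    sub_eq_zero.1 (image_eq_zero_of_notMem_tsupport hx : (q - p) x = 0)
  have hopen : IsOpen (tsupport (q - p))ᶜ := (isClosed_tsupport _).isOpen_compl
  have hhist : ∀ y : Spacetime n, y.2 ∉ tsupport (q - p) →
      T.history k t q y = T.history k t p y := fun y hy => T.history_congr k t hopen hpq hy
  have hz := hJ.integral_sub_eq_zero (T.contDiff_history k t hq) (T.contDiff_history k t hp)
    h hhist t
  have hcont : ∀ {r : Space n → Value S par}, ContDiff ℝ ∞ r →
      Continuous (chargeDensity T J t r) := fun hr =>
    (hJ.1 0).continuous.comp ((Continuous.prodMk_right t).prodMk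
      ((contDiff_jet k (T.contDiff_history k t hr)).continuous.comp (Continuous.prodMk_right t)))
  have hint : Integrable (chargeDensity T J t q - chargeDensity T J t p) := by
    refine ((hcont hq).sub (hcont hp)).integrable_of_hasCompactSupport
      (HasCompactSupport.intro h fun x hx => ?_)
    have : T.history k t q =ᶠ[𝓝 (t, x)] T.history k t p := by
      filter_upwards [(hopen.preimage continuous_snd).mem_nhds
        (show (t, x) ∈ Prod.snd ⁻¹' (tsupport (q - p))ᶜ from hx)] with y hy
      exact hhist y hy
    simp [chargeDensity, jet_congr k this]
  -- The densities differ by an integrable function, so both are integrable or neither is; in the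
  -- latter case both charges take the default value 0.
  by_cases hI : Integrable (chargeDensity T J t p)
  · have hI' : Integrable (chargeDensity T J t q) := by simpa using hint.add hI
    rw [← sub_eq_zero, charge, charge, ← integral_sub hI' hI]
    exact hz
  · have hI' : ¬ Integrable (chargeDensity T J t q) := fun hq' =>
      hI (by simpa using hq'.sub hint)
    rw [charge, charge, integral_undef hI, integral_undef hI']

end History

/-! ### Brackets of functionals with vanishing derivative. -/

section Brackets

variable {n : ℕ} {Λ : Type*} [NormedRing Λ] [NormedAlgebra ℝ Λ]
  {ι : Type*} [Fintype ι] {S : SuperGrading Λ} {par : ι → ZMod 2}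

/-- Functional derivatives are unique on values of the parities of the fields. -/
theorem HasFunctionalDeriv.pairing_eq_zero [CompleteSpace Λ] {F : (Space n → Value S par) → Λ}
    {p : Space n → Value S par} {D : Space n → ι → Λ × Λ} (hD : HasFunctionalDeriv F p D)
    (h0 : HasFunctionalDeriv F p 0) (w : Value S par) (x : Space n) :
    ∑ a, (((w a).1 : Λ) * (D x a).1 + ((w a).2 : Λ) * (D x a).2) = 0 := by
  have hDc : ∀ a, Continuous fun x => D x a := fun a => (continuous_apply a).comp hD.1
  have hc : Continuous fun x => ∑ a, (((w a).1 : Λ) * (D x a).1 + ((w a).2 : Λ) * (D x a).2) :=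
    continuous_finsetSum _ fun a _ => (continuous_const.mul (hDc a).fst).add
      (continuous_const.mul (hDc a).snd)
  -- Fundamental lemma of the calculus of variations, tested with scalar bumps times the fixed value
  -- `w`; continuity then upgrades a.e. vanishing to every point.
  have hae := ae_eq_zero_of_integral_contDiff_smul_eq_zero (μ := volume)
    hc.locallyIntegrable fun g hg hgs => by
      have hη : IsTest fun x : Space n => g x • w := ⟨hg.smul contDiff_const, hgs.smul_right⟩
      have := (hD.2 _ hη).unique (h0.2 _ hη)
      simpa [Finset.smul_sum, smul_add] using this
  exact congrFun ((Continuous.ae_eq_iff_eq volume hc continuous_const).1 hae) x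

/-- A functional with vanishing functional derivative has vanishing brackets. -/
theorem hasBracket_iff_eq_zero [CompleteSpace Λ] {F G : (Space n → Value S par) → Λ}
    {p X : Space n → Value S par} (h0 : HasFunctionalDeriv F p 0)
    (hX : IsHamiltonianField G p X) (c : Λ) : HasBracket F G p c ↔ c = 0 := by
  constructor
  -- `D` itself need not be zero, since variations only take values of the prescribed parities. The
  -- bracket sees only the pairings of `D` with such values.
  · rintro ⟨D, Y, hD, -, -, rfl⟩
    simp [hD.pairing_eq_zero h0]
  · rintro rfl
    exact ⟨0, X, h0, hX, by simp, by simp⟩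

-- The minus sign in the momentum slot cancels the one in the Hamiltonian pairing, which leaves the
-- pairing of the functional derivative.
open Classical in
theorem field_isHamiltonianField [CompleteSpace Λ] (a : ι) {f : Space n → S.part (par a)}
    (hf : IsTest f) {p : Space n → Value S par} (hp : ContDiff ℝ ∞ p) :
    IsHamiltonianField (fieldObs a f) p (fun x => Function.update 0 a (0, -f x)) := by
  refine ⟨continuous_const.update a (continuous_const.prodMk hf.1.continuous.neg), fun η hη => ?_⟩
  convert (field_hasFunctionalDeriv a f hf p hp).2 η hη using 4 with x b
  by_cases h : b = a
  · subst h; simp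
  · simp [h]

end Brackets

end FieldTheory

open FieldTheory
theorem theorem1 {n k : ℕ} {Λ : Type*} [NormedRing Λ] [NormedAlgebra ℝ Λ] [CompleteSpace Λ]
    {ι : Type*} [Fintype ι] (S : SuperGrading Λ) (par : ι → ZMod 2)
    (T : HamiltonianTheory n S par) (J : Current n k S par) (hJ : IsTopologicalCurrent J) :
    (∀ (t : ℝ) (p : Space n → Value S par), ContDiff ℝ ∞ p →
      Integrable (chargeDensity T J t p) →
      -- all functional derivatives `δQ/δφ^a(x)`, `δQ/δπ_a(x)` of the charge vanish
      HasFunctionalDeriv (charge T J t) p 0 ∧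
      -- the charge generates no transformation of `φ` and `π`
      (∀ (a : ι) (f : Space n → S.part (par a)), IsTest f → ∀ c : Λ,
        HasBracket (charge T J t) (fieldObs a f) p c ↔ c = 0) ∧
      (∀ (a : ι) (f : Space n → S.part (par a)), IsTest f → ∀ c : Λ,
        HasBracket (charge T J t) (momentumObs a f) p c ↔ c = 0) ∧
      -- its bracket with every Hamiltonian vanishes, in particular with that of the theory
      (∀ (G : (Space n → Value S par) → Λ) (X : Space n → Value S par),
        IsHamiltonianField G p X → ∀ c : Λ, HasBracket (charge T J t) G p c ↔ c = 0) ∧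
      (∀ c : Λ, HasBracket (charge T J t) (T.hamiltonian t p) p c ↔ c = 0) ∧
      -- if it is conserved, `∂Q/∂t + {Q, H} = 0`, then `∂Q/∂t = 0`
      (∀ q c : Λ, HasDerivAt (fun s => charge T J s p) q t →
        HasBracket (charge T J t) (T.hamiltonian t p) p c → q + c = 0 → q = 0)) ∧
    -- if it is conserved along a motion that is constant in time near spatial infinity, then
    -- it has no explicit time dependence there
    (∀ (t : ℝ) (u : Spacetime n → Value S par), ContDiff ℝ ∞ u → T.IsMotionNear t u →
      (∀ᶠ s in 𝓝 t, HasCompactSupport (fun x => u (s, x) - u (t, x))) →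
      HasDerivAt (fun s => charge T J s (fun x => u (s, x))) 0 t →
      HasDerivAt (fun s => charge T J s (fun x => u (t, x))) 0 t) := by
  constructor
  · intro t p hp _
    have h0 : HasFunctionalDeriv (charge T J t) p 0 := by
      refine ⟨continuous_const, fun η hη => ?_⟩
      have e : (fun ε : ℝ => charge T J t (p + ε • η)) = fun _ => charge T J t p :=
        funext fun ε => charge_eq_of_hasCompactSupport_sub T hJ t hp (hp.add (hη.1.const_smul ε))
          (by rw [add_sub_cancel_left]; exact hη.2.smul_left (f := fun _ => ε))
      simpa [e] using hasDerivAt_const (0 : ℝ) (charge T J t p)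
    have hH := hasBracket_iff_eq_zero h0 (T.hamilton t p hp)
    classical
    exact ⟨h0, fun a f hf => hasBracket_iff_eq_zero h0 (field_isHamiltonianField a hf hp),
      fun a f hf => hasBracket_iff_eq_zero h0 (momentum_ham a f hf p hp),
      fun G X hX => hasBracket_iff_eq_zero h0 hX, hH,
      fun q c _ hc hqc => by simpa [(hH c).1 hc] using hqc⟩
  · intro t u hu _ hsupp hder
    -- For `s` near `t`, `u (s, ·)` and `u (t, ·)` differ by a compactly supported variation, so at
    -- time `s` they carry the same charge: both functions of `s` coincide near `t`.
    refine hder.congr_of_eventuallyEq ?_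
    have hslice : ∀ s, ContDiff ℝ ∞ fun x => u (s, x) := fun s =>
      hu.comp (contDiff_const.prodMk contDiff_id)
    filter_upwards [hsupp] with s hs
    exact (charge_eq_of_hasCompactSupport_sub T hJ s (hslice t) (hslice s) hs).symm
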